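/- Call a join semi-lattice $(X,\le,\sqcup)$ simply a lattice. A quasi-metric on $X$ is a function $\delta_X : X\times X\to [0,\infty]\cup\{\bot\}$ such that for all $a,b,c\in X$: $a=b \Leftrightarrow \delta_X(a,b)=0$; $a\le b\Leftrightarrow \delta_X(a,b)\ne\bot$; and $a\le b\le c\Rightarrow \delta_X(a,c)\le\delta_X(a,b)+\delta_X(b,c)$. Consider $n$ processes running a deterministic protocol in an asynchronous message-passing system. In each step a single process receives at most one of the messages in transit to it, changes its local state, and sends finitely many messages to processes of its choice (possibly itself). Steps are interleaved arbitrarily. A process is correct in an infinite run if it takes infinitely many steps, and otherwise it crashes. A run is admissible for $f$ if at most $f$ processes crash and every message sent to a correct process is eventually received. Decisions are irrevocable. For $\varepsilon\ge 0$, a protocol solves the asynchronous $\varepsilon$-bounded lattice agreement problem on $(X,\delta_X)$ with at most $f$ crash faults if, for all inputs $x_1,\dots,x_n\in X$ and in every run admissible for $f$, every correct process $p_i$ eventually decides on some $y_i\in X$, and for all correct $p_i,p_j$: \begin{itemize} \item Downward-Validity: $x_i\le y_i$; \item Upward-Validity: $y_i\le\bigsqcup_{k=1}^n x_k$; \item Comparability: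 $y_i\le y_j$ or $y_j\le y_i$; \item $\varepsilon$-Tightness: if $y_i\le y_j$ then $\delta_X(y_i,y_j)\le\varepsilon$. \end{itemize} \textbf{Theorem.} Let $n\ge 2$ and $f\ge 1$, and let $X$ be a lattice with at least two elements and with a quasi-metric $\delta_X$. Then no protocol solves the asynchronous $0$-bounded lattice agreement problem on $(X,\delta_X)$ with at most $f$ crash faults. In particular, this holds for the two-element lattice $\{0<1\}$. -/

import Mathlib

open scoped ENNReal

universe u v w

/-- A quasi-metric on a join semi-lattice `X`, with values in `[0, ∞] ∪ {⊥}`. The value `⊥` marks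
the pairs that are not in the relation `≤`; by `ne_bot_iff` it does not occur in `triangle`. -/
structure LatticeQuasiMetric (X : Type u) [SemilatticeSup X] where
  dist : X → X → WithBot ℝ≥0∞
  eq_iff : ∀ a b, a = b ↔ dist a b = 0
  ne_bot_iff : ∀ a b, a ≤ b ↔ dist a b ≠ ⊥
  triangle : ∀ a b c, a ≤ b → b ≤ c → dist a c ≤ dist a b + dist b c

/-- The requirements of `ε`-bounded lattice agreement on the inputs `x` and the outputs `y`,
imposed on the outputs of the processes in `S` (the correct ones). The join in `upward` is over
the inputs of all processes. -/
structure IsBoundedLatticeAgreement {X : Type u} [SemilatticeSup X] (δ : LatticeQuasiMetric X)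
    (ε : ℝ≥0∞) {n : ℕ} (S : Set (Fin n)) (x y : Fin n → X) : Prop where
  downward : ∀ i ∈ S, x i ≤ y i
  upward : ∀ i ∈ S, y i ≤ Finset.univ.sup' ⟨i, Finset.mem_univ i⟩ x
  comparable : ∀ i ∈ S, ∀ j ∈ S, y i ≤ y j ∨ y j ≤ y i
  tight : ∀ i ∈ S, ∀ j ∈ S, y i ≤ y j → δ.dist (y i) (y j) ≤ (ε : WithBot ℝ≥0∞)

/-- A deterministic message-passing protocol for `n` processes with inputs and outputs in `X`.
In one step, process `i` in state `s` receives a message or nothing (`none`), passes to a new state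
and sends finitely many messages, each to a process of its choice (possibly itself).
`output s` is the value decided in state `s`, if any; a decision is irrevocable. -/
structure AsyncProtocol (n : ℕ) (X : Type u) where
  State : Type v
  Msg : Type w
  init : Fin n → X → State
  step : Fin n → State → Option Msg → State × List (Fin n × Msg)
  output : State → Option X
  output_stable : ∀ i s m v, output s = some v → output (step i s m).1 = some v

namespace AsyncProtocol

variable {n : ℕ} {X : Type u}

/-- A global configuration: the local states, and the messages in transit, each with its
destination. -/
structure Config (P : AsyncProtocol.{u, v, w} n X) where
  state : Fin n → P.State
  buffer : Multiset (Fin n × P.Msg)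

/-- The initial configuration for the inputs `x`: no message is in transit. -/
def initial (P : AsyncProtocol.{u, v, w} n X) (x : Fin n → X) : P.Config where
  state i := P.init i (x i)
  buffer := 0

/-- What process `i` takes out of the buffer: the message it receives, or nothing. -/
def taken (P : AsyncProtocol.{u, v, w} n X) (i : Fin n) :
    Option P.Msg → Multiset (Fin n × P.Msg)
  | none => 0
  | some m => {(i, m)}

/-- `C'` arises from `C` when process `i` takes a step in which it receives `m`. A message must be
in transit to be received; receiving nothing is always possible. -/
def Step (P : AsyncProtocol.{u, v, w} n X) (C : P.Config) (i : Fin n) (m : Option P.Msg)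
    (C' : P.Config) : Prop :=
  ∃ rest : Multiset (Fin n × P.Msg),
    C.buffer = P.taken i m + rest ∧
    C'.buffer = rest + ((P.step i (C.state i) m).2 : Multiset (Fin n × P.Msg)) ∧
    C'.state = Function.update C.state i (P.step i (C.state i) m).1

/-- An infinite asynchronous run on the inputs `x`: the processes take steps one at a time, in any
order; at time `t` the process `proc t` receives `recv t`. -/
structure Run (P : AsyncProtocol.{u, v, w} n X) (x : Fin n → X) where
  config : ℕ → P.Config
  proc : ℕ → Fin n
  recv : ℕ → Option P.Msg
  start : config 0 = P.initial x
  next : ∀ t, P.Step (config t) (proc t) (recv t) (config (t + 1))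

namespace Run

variable {P : AsyncProtocol.{u, v, w} n X} {x : Fin n → X}

/-- The correct processes of a run take infinitely many steps; the others crash, that is, take no
step from some time on. -/
def correct (R : P.Run x) : Set (Fin n) :=
  {i | ∀ t, ∃ t' ≥ t, R.proc t' = i}

/-- At most `f` processes crash, and every message to a correct process is eventually received. -/
def Admissible (R : P.Run x) (f : ℕ) : Prop :=
  (R.correct)ᶜ.ncard ≤ f ∧
  ∀ i ∈ R.correct, ∀ t m, (i, m) ∈ (R.config t).buffer →
    ∃ t' ≥ t, R.proc t' = i ∧ R.recv t' = some m

/-- Process `i` decides on `v` at some time of the run. -/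
def Decides (R : P.Run x) (i : Fin n) (v : X) : Prop :=
  ∃ t, P.output ((R.config t).state i) = some v

end Run

/-- `P` solves `ε`-bounded lattice agreement with at most `f` crash faults: for all inputs and in
all admissible runs, every correct process eventually decides, and the decisions of the correct
processes meet the requirements. -/
def SolvesBoundedLatticeAgreement [SemilatticeSup X] (P : AsyncProtocol.{u, v, w} n X)
    (δ : LatticeQuasiMetric X) (ε : ℝ≥0∞) (f : ℕ) : Prop :=
  ∀ (x : Fin n → X) (R : P.Run x), R.Admissible f →
    ∃ y : Fin n → X, (∀ i ∈ R.correct, R.Decides i (y i)) ∧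
      IsBoundedLatticeAgreement δ ε R.correct x y

end AsyncProtocol

namespace LatticeQuasiMetric

variable {X : Type u} [SemilatticeSup X]

/-! For `ε = 0`, comparability and tightness force all correct processes to decide the same value.
Take `a < b` and give every process input `a`. If `p` never moves, validity makes `q` decide `a` by
some finite time `T`. Up to `T` nobody can tell whether the input of `p` is `a` or `b`, so the same
steps are possible with input `b`. Let everyone run fairly afterwards: `q` is bound to `a`, while
downward validity forces `p` to decide a value above `b`. No bivalence argument is needed. The run
with `p` silent comes from `exists_fair_execution`; `Execution.reaches_withState` changes the input
of `p`, and `exists_fair_execution_through` extends the finite prefix. -/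

theorem eq_of_le_of_dist_le_zero (δ : LatticeQuasiMetric X) {a b : X} (hab : a ≤ b)
    (h : δ.dist a b ≤ ((0 : ℝ≥0∞) : WithBot ℝ≥0∞)) : a = b := by
  -- The bound alone does not suffice, since `⊥ ≤ 0` too; `a ≤ b` excludes `⊥`.
  have hbot := (δ.ne_bot_iff a b).1 hab
  rw [δ.eq_iff]
  obtain ⟨d, hd⟩ := WithBot.ne_bot_iff_exists.1 hbot
  rw [← hd] at h ⊢
  have hd0 : d = 0 := le_antisymm (WithBot.coe_le_coe.1 h) bot_le
  rw [hd0]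
  rfl

end LatticeQuasiMetric

theorem IsBoundedLatticeAgreement.eq_of_zero {X : Type u} [SemilatticeSup X]
    {δ : LatticeQuasiMetric X} {n : ℕ} {S : Set (Fin n)} {x y : Fin n → X}
    (h : IsBoundedLatticeAgreement δ 0 S x y) {i j : Fin n} (hi : i ∈ S) (hj : j ∈ S) :
    y i = y j := by
  rcases h.comparable i hi j hj with hij | hji
  · exact δ.eq_of_le_of_dist_le_zero hij (h.tight i hi j hj hij)
  · exact (δ.eq_of_le_of_dist_le_zero hji (h.tight j hj i hi hji)).symm

/-- A schedule in which exactly the members of `S` occur, each of them infinitely often. -/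
theorem exists_fair_schedule {α : Type*} [Countable α] {S : Set α} (hS : S.Nonempty) :
    ∃ s : ℕ → α, (∀ t, s t ∈ S) ∧ ∀ i ∈ S, ∀ t, ∃ t' ≥ t, s t' = i := by
  have : Nonempty S := hS.to_subtype
  obtain ⟨g, hg⟩ := exists_surjective_nat S
  -- Each index `k` recurs at the times `Nat.pair k t ≥ t`, for every `t`.
  refine ⟨fun t => g t.unpair.1, fun t => (g _).2, fun i hi t => ?_⟩
  obtain ⟨k, hk⟩ := hg ⟨i, hi⟩
  exact ⟨Nat.pair k t, Nat.right_le_pair k t, by simp [hk]⟩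

namespace AsyncProtocol

variable {n : ℕ} {X : Type u}

/-- An infinite execution from an arbitrary configuration. -/
structure Execution (P : AsyncProtocol.{u, v, w} n X) where
  config : ℕ → P.Config
  proc : ℕ → Fin n
  recv : ℕ → Option P.Msg
  next : ∀ t, P.Step (config t) (proc t) (recv t) (config (t + 1))

/-- Every process in `S` takes infinitely many steps and receives every message sent to it. -/
def Execution.FairFor {P : AsyncProtocol.{u, v, w} n X} (E : P.Execution) (S : Set (Fin n)) :
    Prop :=
  (∀ i ∈ S, ∀ t, ∃ t' ≥ t, E.proc t' = i) ∧
  ∀ i ∈ S, ∀ t m, (i, m) ∈ (E.config t).buffer → ∃ t' ≥ t, E.proc t' = i ∧ E.recv t' = some m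

/-! ### Fair executions by first-in-first-out delivery -/

section Queues

variable {M : Type w}

/-- The messages addressed to `k`, in order. -/
def messagesTo (l : List (Fin n × M)) (k : Fin n) : List M :=
  (l.filter fun p => p.1 = k).map Prod.snd

/-- The multiset of messages in transit when they are kept in one queue for each process. -/
def bufferOfQueues (q : Fin n → List M) : Multiset (Fin n × M) :=
  ∑ k, ((q k : Multiset M).map (Prod.mk k))

theorem mem_bufferOfQueues {q : Fin n → List M} {i : Fin n} {m : M} :
    (i, m) ∈ bufferOfQueues q ↔ m ∈ q i := by
  simp [bufferOfQueues, Multiset.mem_sum]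

theorem bufferOfQueues_append (q r : Fin n → List M) :
    bufferOfQueues (fun k => q k ++ r k) = bufferOfQueues q + bufferOfQueues r := by
  simp only [bufferOfQueues, ← Finset.sum_add_distrib, ← Multiset.coe_add, Multiset.map_add]

theorem bufferOfQueues_single (i : Fin n) (l : List M) :
    bufferOfQueues (fun k => if k = i then l else []) = (l : Multiset M).map (Prod.mk i) := by
  rw [bufferOfQueues, Finset.sum_eq_single i] <;> simp +contextual

theorem bufferOfQueues_messagesTo (l : List (Fin n × M)) :
    bufferOfQueues (messagesTo l) = (l : Multiset (Fin n × M)) := by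
  induction l with
  | nil => simp [bufferOfQueues, messagesTo]
  | cons a l ih =>
    have h : messagesTo (a :: l) =
        fun k => (if k = a.1 then [a.2] else []) ++ messagesTo l k := by
      funext k
      by_cases hk : a.1 = k
      · simp [messagesTo, hk]
      · simp [messagesTo, hk, Ne.symm hk]
    rw [h, bufferOfQueues_append, bufferOfQueues_single, ih]
    simp

end Queues

/-- A configuration in which the messages in transit to each process form a queue. -/
structure QueueConfig (P : AsyncProtocol.{u, v, w} n X) where
  state : Fin n → P.State
  queue : Fin n → List P.Msg

namespace QueueConfig

variable {P : AsyncProtocol.{u, v, w} n X}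

/-- Forget the order of the messages. -/
def toConfig (Q : P.QueueConfig) : P.Config := ⟨Q.state, bufferOfQueues Q.queue⟩

/-- Process `i` takes a step in which it receives the oldest message sent to it, if any. -/
def advance (Q : P.QueueConfig) (i : Fin n) : P.QueueConfig where
  state := Function.update Q.state i (P.step i (Q.state i) (Q.queue i).head?).1
  queue k := (if k = i then (Q.queue i).tail else Q.queue k) ++
    messagesTo (P.step i (Q.state i) (Q.queue i).head?).2 k

theorem step_advance (Q : P.QueueConfig) (i : Fin n) :
    P.Step Q.toConfig i (Q.queue i).head? (Q.advance i).toConfig := by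
  refine ⟨bufferOfQueues fun k => if k = i then (Q.queue i).tail else Q.queue k, ?_, ?_, rfl⟩
  · have hq : Q.queue = fun k => (if k = i then (Q.queue i).head?.toList else []) ++
        (if k = i then (Q.queue i).tail else Q.queue k) := by
      funext k
      by_cases hk : k = i
      · subst hk
        cases h : Q.queue k <;> simp
      · simp [hk]
    have ht : P.taken i (Q.queue i).head? =
        (((Q.queue i).head?.toList : List P.Msg) : Multiset P.Msg).map (Prod.mk i) := by
      cases (Q.queue i).head? <;> simp [taken]
    rw [ht, ← bufferOfQueues_single, ← bufferOfQueues_append, ← hq]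
    rfl
  · simp only [toConfig, advance]
    rw [bufferOfQueues_append, bufferOfQueues_messagesTo]

theorem exists_toConfig_eq (C : P.Config) : ∃ Q : P.QueueConfig, Q.toConfig = C := by
  refine ⟨⟨C.state, messagesTo C.buffer.toList⟩, ?_⟩
  simp [toConfig, bufferOfQueues_messagesTo]

/-- The configurations that arise when the processes take steps in the order `s`. -/
def iterate (Q : P.QueueConfig) (s : ℕ → Fin n) : ℕ → P.QueueConfig
  | 0 => Q
  | t + 1 => (iterate Q s t).advance (s t)

/-- Induction on the messages `u` ahead of `m`: each step of `i` removes one of them, and new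
messages only join behind `m`. -/
theorem received_of_queue_eq (Q : P.QueueConfig) (s : ℕ → Fin n) (i : Fin n)
    (hs : ∀ t, ∃ t' ≥ t, s t' = i) (m : P.Msg) (u : List P.Msg) :
    ∀ (t : ℕ) (v : List P.Msg), (Q.iterate s t).queue i = u ++ m :: v →
      ∃ t' ≥ t, s t' = i ∧ ((Q.iterate s t').queue i).head? = some m := by
  -- Until `i` takes a step, its queue is only extended at the end.
  have wait : ∀ (l : List P.Msg) (d t : ℕ) (v : List P.Msg), s (t + d) = i →
      (Q.iterate s t).queue i = l ++ v →
      ∃ t' ≥ t, s t' = i ∧ ∃ v', (Q.iterate s t').queue i = l ++ v' := by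
    intro l d
    induction d with
    | zero => exact fun t v hd hq => ⟨t, le_rfl, hd, v, hq⟩
    | succ d ih =>
      intro t v hd hq
      by_cases hi : s t = i
      · exact ⟨t, le_rfl, hi, v, hq⟩
      · obtain ⟨t', ht', h⟩ := ih (t + 1)
          (v ++ messagesTo (P.step (s t) ((Q.iterate s t).state (s t))
            ((Q.iterate s t).queue (s t)).head?).2 i)
          (by rw [← hd]; congr 1; omega)
          (by simp [iterate, advance, Ne.symm hi, hq])
        exact ⟨t', by omega, h⟩
  induction u with
  | nil =>
    intro t v hq
    obtain ⟨t₁, ht₁, hs₁⟩ := hs t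
    obtain ⟨t', ht', hs', v', hv'⟩ := wait [m] (t₁ - t) t v
      (by rw [Nat.add_sub_cancel' ht₁, hs₁]) (by simpa using hq)
    exact ⟨t', ht', hs', by simp [hv']⟩
  | cons a u ih =>
    intro t v hq
    obtain ⟨t₁, ht₁, hs₁⟩ := hs t
    -- The preserved prefix includes `m`, so its position is known when `a` is removed.
    obtain ⟨t', ht', hs', v', hv'⟩ := wait (a :: u ++ [m]) (t₁ - t) t v
      (by rw [Nat.add_sub_cancel' ht₁, hs₁]) (by simpa using hq)
    obtain ⟨t'', ht'', h⟩ := ih (t' + 1)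
      (v' ++ messagesTo (P.step i ((Q.iterate s t').state i)
        ((Q.iterate s t').queue i).head?).2 i)
      (by simp [iterate, advance, hs', hv'])
    exact ⟨t'', by omega, h⟩

end QueueConfig

variable {P : AsyncProtocol.{u, v, w} n X}

/-- From every configuration, there is an execution in which exactly the processes in `S` take
steps, and which is fair for them. -/
theorem exists_fair_execution (C : P.Config) {S : Set (Fin n)} (hS : S.Nonempty) :
    ∃ E : P.Execution, E.config 0 = C ∧ (∀ t, E.proc t ∈ S) ∧ E.FairFor S := by
  obtain ⟨Q, rfl⟩ := QueueConfig.exists_toConfig_eq C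
  obtain ⟨s, hsS, hs⟩ := exists_fair_schedule hS
  refine ⟨⟨fun t => (Q.iterate s t).toConfig, s, fun t => ((Q.iterate s t).queue (s t)).head?,
    fun t => (Q.iterate s t).step_advance (s t)⟩, rfl, hsS, hs, fun i hi t m hm => ?_⟩
  obtain ⟨u, v, huv⟩ := List.append_of_mem (mem_bufferOfQueues.1 hm)
  obtain ⟨t', ht', hst', h⟩ := Q.received_of_queue_eq s i (hs i hi) m u t v huv
  exact ⟨t', ht', hst', by simpa only [hst'] using h⟩

/-! ### Finite prefixes of fair executions -/

/-- Some process takes a step from `C` to `C'`. -/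
def StepsTo (P : AsyncProtocol.{u, v, w} n X) (C C' : P.Config) : Prop :=
  ∃ i m, P.Step C i m C'

theorem mem_buffer_of_step {C C' : P.Config} {i : Fin n} {m : Option P.Msg}
    (h : P.Step C i m C') {j : Fin n} {a : P.Msg} (ha : (j, a) ∈ C.buffer) :
    (i = j ∧ m = some a) ∨ (j, a) ∈ C'.buffer := by
  obtain ⟨rest, hC, hC', -⟩ := h
  rw [hC, Multiset.mem_add] at ha
  rcases ha with ha | ha
  · left
    cases m with
    | none => simp [taken] at ha
    | some b =>
      simp only [taken, Multiset.mem_singleton, Prod.mk.injEq] at ha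
      exact ⟨ha.1.symm, by rw [ha.2]⟩
  · right
    rw [hC']
    exact Multiset.mem_add.2 (Or.inl ha)

/-- A finite sequence of steps can be put before a fair execution. -/
theorem exists_fair_execution_through {C C' : P.Config} {S : Set (Fin n)} (hS : S.Nonempty)
    (h : Relation.ReflTransGen P.StepsTo C C') :
    ∃ E : P.Execution, E.config 0 = C ∧ E.FairFor S ∧ ∃ t, E.config t = C' := by
  induction h using Relation.ReflTransGen.head_induction_on with
  | refl =>
    obtain ⟨E, h0, -, hE⟩ := exists_fair_execution C' hS
    exact ⟨E, h0, hE, 0, h0⟩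
  | @head C C₁ hstep _ ih =>
    obtain ⟨i, a, hstep⟩ := hstep
    obtain ⟨E, h0, ⟨hinf, hfair⟩, T, hT⟩ := ih
    let E' : P.Execution := ⟨fun t => Nat.casesOn t C E.config, fun t => Nat.casesOn t i E.proc,
      fun t => Nat.casesOn t a E.recv, by
        rintro (_ | t)
        · change P.Step C i a (E.config 0)
          rwa [h0]
        · exact E.next t⟩
    have shift : ∀ j ∈ S, ∀ t m, (j, m) ∈ (E.config t).buffer →
        ∃ t' ≥ t + 1, E'.proc t' = j ∧ E'.recv t' = some m := by
      intro j hj t m hm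
      obtain ⟨t', ht', h⟩ := hfair j hj t m hm
      exact ⟨t' + 1, by omega, h⟩
    refine ⟨E', rfl, ⟨fun j hj t => ?_, ?_⟩, T + 1, hT⟩
    · obtain ⟨t', ht', h⟩ := hinf j hj t
      exact ⟨t' + 1, by omega, h⟩
    · rintro j hj (_ | t) m hm
      -- A message in transit at time `0` is either received in the added step or still in transit
      -- when `E` begins.
      · rcases mem_buffer_of_step hstep hm with h | h
        · exact ⟨0, le_rfl, h⟩
        · rw [← h0] at h
          obtain ⟨t', -, h'⟩ := shift j hj 0 m h
          exact ⟨t', Nat.zero_le _, h'⟩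
      · exact shift j hj t m hm

/-! ### Indistinguishability, irrevocability and the contradiction -/

/-- The configuration `C` with the local state of `p` replaced by `s`. -/
def Config.withState (C : P.Config) (p : Fin n) (s : P.State) : P.Config :=
  ⟨Function.update C.state p s, C.buffer⟩

/-- The steps of the other processes do not depend on the state of `p`. -/
theorem Step.withState {C C' : P.Config} {i p : Fin n} {m : Option P.Msg}
    (h : P.Step C i m C') (hip : i ≠ p) (s : P.State) :
    P.Step (C.withState p s) i m (C'.withState p s) := by
  obtain ⟨rest, hC, hC', hs⟩ := h
  have hi : (C.withState p s).state i = C.state i := Function.update_of_ne hip _ _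
  refine ⟨rest, hC, by rw [hi]; exact hC', ?_⟩
  rw [hi]
  simp only [Config.withState, hs]
  exact Function.update_comm hip _ _ _

/-- A process that never moves sends nothing and its state is never read, so the execution can be
replayed with any other state there. -/
theorem Execution.reaches_withState (E : P.Execution) {p : Fin n} (hp : ∀ t, E.proc t ≠ p)
    (s : P.State) (t : ℕ) :
    Relation.ReflTransGen P.StepsTo ((E.config 0).withState p s) ((E.config t).withState p s) := by
  induction t with
  | zero => exact .refl
  | succ t ih => exact ih.tail ⟨_, _, (E.next t).withState (hp t) s⟩

theorem output_of_step {C C' : P.Config} {i j : Fin n} {m : Option P.Msg} {a : X}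
    (h : P.Step C i m C') (hj : P.output (C.state j) = some a) :
    P.output (C'.state j) = some a := by
  obtain ⟨-, -, -, hs⟩ := h
  rw [hs]
  by_cases hij : j = i
  · subst hij
    rw [Function.update_self]
    exact P.output_stable _ _ _ _ hj
  · rwa [Function.update_of_ne hij]

namespace Run

variable {x : Fin n → X}

theorem output_mono (R : P.Run x) {i : Fin n} {a : X} {s t : ℕ} (hst : s ≤ t)
    (h : P.output ((R.config s).state i) = some a) :
    P.output ((R.config t).state i) = some a := by
  induction t, hst using Nat.le_induction with
  | base => exact h
  | succ t _ ih => exact output_of_step (R.next t) ih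

theorem Decides.unique {R : P.Run x} {i : Fin n} {a b : X} (ha : R.Decides i a)
    (hb : R.Decides i b) : a = b := by
  obtain ⟨s, hs⟩ := ha
  obtain ⟨t, ht⟩ := hb
  exact Option.some.inj
    ((R.output_mono (le_max_left s t) hs).symm.trans (R.output_mono (le_max_right s t) ht))

end Run

/-- An execution from an initial configuration is a run. -/
def Execution.toRun (E : P.Execution) {x : Fin n → X} (h : E.config 0 = P.initial x) : P.Run x :=
  ⟨E.config, E.proc, E.recv, h, E.next⟩

theorem not_solves_zero [SemilatticeSup X] [Nontrivial X] (δ : LatticeQuasiMetric X)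
    {f : ℕ} (hn : 2 ≤ n) (hf : 1 ≤ f) : ¬ P.SolvesBoundedLatticeAgreement δ 0 f := by
  intro hP
  obtain ⟨a, b, hab⟩ : ∃ a b : X, a < b := by
    obtain ⟨c, d, hcd⟩ := exists_pair_ne X
    by_cases h : c ≤ d
    · exact ⟨c, d, lt_of_le_of_ne h hcd⟩
    · exact ⟨d, c ⊔ d, right_lt_sup.2 h⟩
  let p : Fin n := ⟨0, by omega⟩
  let q : Fin n := ⟨1, by omega⟩
  have hqp : q ≠ p := by simp [p, q]
  -- All inputs are `a` and `p` takes no step: `q` decides on `a` at some time `T`.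
  obtain ⟨E, hE0, hEp, hinf, hfair⟩ :=
    exists_fair_execution (P.initial fun _ => a) (S := {p}ᶜ) ⟨q, hqp⟩
  let R := E.toRun hE0
  have hcorrect : R.correct = {p}ᶜ := by
    ext i
    refine ⟨fun hi => ?_, hinf i⟩
    obtain ⟨t, -, ht⟩ := hi 0
    exact ht ▸ hEp t
  have hR : R.Admissible f := by
    refine ⟨?_, fun i hi => hfair i (hcorrect ▸ hi)⟩
    -- The only crash is that of `p`; this is where `1 ≤ f` enters.
    rw [hcorrect, compl_compl, Set.ncard_singleton]
    exact hf
  obtain ⟨y, hdec, hy⟩ := hP _ R hR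
  have hq : q ∈ R.correct := by rw [hcorrect]; exact hqp
  have hyq : y q = a := by
    refine le_antisymm ((hy.upward q hq).trans ?_) (hy.downward q hq)
    exact Finset.sup'_le _ _ fun _ _ => le_rfl
  obtain ⟨T, hT⟩ := hdec q hq
  rw [hyq] at hT
  -- The same steps with input `b` at `p`, after which all processes are correct.
  let x : Fin n → X := Function.update (fun _ => a) p b
  have hx : (E.config 0).withState p (P.init p b) = P.initial x := by
    rw [hE0]
    simp only [Config.withState, initial, Config.mk.injEq, and_true]
    funext i
    by_cases hi : i = p
    · subst hi; simp [x]
    · simp [x, hi]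
  obtain ⟨E', hE'0, ⟨hinf', hfair'⟩, T', hT'⟩ := exists_fair_execution_through
    (S := Set.univ) ⟨p, trivial⟩ (E.reaches_withState hEp (P.init p b) T)
  let R' := E'.toRun (hE'0.trans hx)
  have hcorrect' : R'.correct = Set.univ := Set.eq_univ_of_forall fun i => hinf' i trivial
  have hR' : R'.Admissible f := by
    refine ⟨?_, fun i _ => hfair' i trivial⟩
    rw [hcorrect', Set.compl_univ, Set.ncard_empty]
    exact Nat.zero_le f
  obtain ⟨y', hdec', hy'⟩ := hP _ R' hR'
  have hmem (i : Fin n) : i ∈ R'.correct := by rw [hcorrect']; trivial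
  have hqa : R'.Decides q a := by
    refine ⟨T', ?_⟩
    change P.output ((E'.config T').state q) = some a
    rw [hT']
    simp only [Config.withState, Function.update_of_ne hqp]
    exact hT
  have hyq' : y' q = a := (hdec' q (hmem q)).unique hqa
  have hbp : b ≤ y' p := by simpa [x] using hy'.downward p (hmem p)
  rw [hy'.eq_of_zero (hmem p) (hmem q), hyq'] at hbp
  exact hab.not_ge hbp

end AsyncProtocol

theorem mainTheorem2 {X : Type u} [SemilatticeSup X] [Nontrivial X] (δ : LatticeQuasiMetric X)
    (n f : ℕ) (hn : 2 ≤ n) (hf : 1 ≤ f) :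
    ¬ ∃ P : AsyncProtocol.{u, v, w} n X, P.SolvesBoundedLatticeAgreement δ 0 f := by
  rintro ⟨P, hP⟩
  exact AsyncProtocol.not_solves_zero δ hn hf hP
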